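/- **Theorem 1.4.** Let $X$ be a zero-dimensional (equivalently, totally disconnected) compact Hausdorff space and let $f\colon X\to X$ be a continuous map which is chain transitive and has the shadowing property. Then $f$ has the $\mathcal{D}$-shadowing property (DSP). Here the terms are as follows. Let $\mathscr{U}(X)$ be the set of finite open covers of $X$, and for $\mathcal{U}\in\mathscr{U}(X)$ call two points $\mathcal{U}$-close if some member of $\mathcal{U}$ contains both. * A $\mathcal{U}$-chain of length $k\ge 1$ from $x$ to $y$ is a sequence $(x_i)_{i=0}^k$ with $x_0=x$, $x_k=y$ such that $f(x_i)$ and $x_{i+1}$ are $\mathcal{U}$-close for $0\le i<k$; it is a $\mathcal{U}$-cycle if $x_0=x_k$. A $\mathcal{U}$-pseudo orbit is a sequence $(x_i)_{i\ge0}$ such that $f(x_i)$ and $x_{i+1}$ are $\mathcal{U}$-close for all $i\ge0$. A sequence $(x_i)_{i\ge0}$ is $\mathcal{V}$-shadowed by $x$ if $f^i(x)$ and $x_i$ are $\mathcal{V}$-close for all $i\ge0$. * $f$ has the shadowing property if for every $\mathcal{V}\in\mathscr{U}(X)$ there is $\mathcal{U}\in\mathscr{U}(X)$ such that every $\mathcal{U}$-pseudo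 orbit is $\mathcal{V}$-shadowed by some point of $X$. * $f$ is chain transitive if for all $x,y\in X$ and $\mathcal{U}\in\mathscr{U}(X)$ there is a $\mathcal{U}$-chain from $x$ to $y$. * For $f$ chain transitive, let $m(\mathcal{U})$ be the greatest common divisor of the lengths of all $\mathcal{U}$-cycles. Write $x\sim_{f,\mathcal{U}}y$ if there is a $\mathcal{U}$-chain from $x$ to $y$ whose length is divisible by $m(\mathcal{U})$, and $x\sim_f y$ if $x\sim_{f,\mathcal{U}}y$ for all $\mathcal{U}\in\mathscr{U}(X)$. Then $\sim_f$ is an equivalence relation; let $\mathcal{D}(f)$ be its set of equivalence classes. * $f$ has DSP if for every $\mathcal{V}\in\mathscr{U}(X)$ there is $\mathcal{U}\in\mathscr{U}(X)$ such that, for every $D\in\mathcal{D}(f)$, every $\mathcal{U}$-pseudo orbit $(x_i)_{i\ge0}$ with $x_0\in D$ is $\mathcal{V}$-shadowed by some point $x\in D$. -/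

import Mathlib

open Set

namespace DShadowing

/-- A finite open cover of `X`: a finite set of open subsets of `X` whose union is `X`. -/
structure FiniteOpenCover (X : Type*) [TopologicalSpace X] where
  sets : Set (Set X)
  finite_sets : sets.Finite
  isOpen_of_mem : ∀ U ∈ sets, IsOpen U
  sUnion_sets : ⋃₀ sets = univ

variable {X : Type*} [TopologicalSpace X]

/-- `a` and `b` lie in a common member of the cover `U`. -/
def Close (U : FiniteOpenCover X) (a b : X) : Prop :=
  ∃ W ∈ U.sets, a ∈ W ∧ b ∈ W

/-- `(x 0, …, x k)`, with `k > 0`, is a `U`-chain of `f`. The chain is given by a function on `ℕ`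
of which only the values at `0, …, k` matter. -/
def IsChainOf (U : FiniteOpenCover X) (f : X → X) (k : ℕ) (x : ℕ → X) : Prop :=
  0 < k ∧ ∀ i < k, Close U (f (x i)) (x (i + 1))

/-- `(x 0, …, x k)` is a `U`-cycle of `f`, of length `k`. -/
def IsCycleOf (U : FiniteOpenCover X) (f : X → X) (k : ℕ) (x : ℕ → X) : Prop :=
  IsChainOf U f k x ∧ x 0 = x k

/-- `U`-pseudo orbits of `f`. -/
def IsPseudoOrbit (U : FiniteOpenCover X) (f : X → X) (ξ : ℕ → X) : Prop :=
  ∀ i, Close U (f (ξ i)) (ξ (i + 1))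

/-- The sequence `ξ` is `V`-shadowed by the point `x`. -/
def IsShadowedBy (V : FiniteOpenCover X) (f : X → X) (ξ : ℕ → X) (x : X) : Prop :=
  ∀ i, Close V (f^[i] x) (ξ i)

/-- The shadowing property. -/
def HasShadowing (f : X → X) : Prop :=
  ∀ V : FiniteOpenCover X, ∃ U : FiniteOpenCover X,
    ∀ ξ : ℕ → X, IsPseudoOrbit U f ξ → ∃ x : X, IsShadowedBy V f ξ x

/-- Chain transitivity. -/
def ChainTransitive (f : X → X) : Prop :=
  ∀ (x y : X) (U : FiniteOpenCover X), ∃ (k : ℕ) (c : ℕ → X),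
    IsChainOf U f k c ∧ c 0 = x ∧ c k = y

/-- The set of lengths of the `U`-cycles of `f`. -/
def cycleLengths (U : FiniteOpenCover X) (f : X → X) : Set ℕ :=
  {k | ∃ c : ℕ → X, IsCycleOf U f k c}

/-- `m(U)`: the greatest common divisor of the lengths of all `U`-cycles of `f`. (All lengths are
positive, so as soon as there is a cycle the set of common divisors is finite and contains `1`.) -/
noncomputable def cycleGcd (U : FiniteOpenCover X) (f : X → X) : ℕ :=
  sSup {d : ℕ | ∀ k ∈ cycleLengths U f, d ∣ k}

/-- The relation `x ∼_{f,U} y`: some `U`-chain from `x` to `y` has length divisible by `m(U)`. -/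
def CoverRel (U : FiniteOpenCover X) (f : X → X) (x y : X) : Prop :=
  ∃ (k : ℕ) (c : ℕ → X), IsChainOf U f k c ∧ c 0 = x ∧ c k = y ∧ cycleGcd U f ∣ k

/-- The relation `x ∼_f y`: `x ∼_{f,U} y` for every finite open cover `U`. -/
def Rel (f : X → X) (x y : X) : Prop :=
  ∀ U : FiniteOpenCover X, CoverRel U f x y

/-- `𝒟(f)`: the set of equivalence classes of `∼_f` (which is an equivalence relation whenever `f`
is continuous and chain transitive). -/
def classes (f : X → X) : Set (Set X) :=
  {D | ∃ x : X, D = {y | Rel f x y}}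

/-- `𝒟^{V,U}(f)`: the classes `D` such that every `U`-pseudo orbit starting in `D` is `V`-shadowed
by some point of `D`. -/
def shadowingClasses (V U : FiniteOpenCover X) (f : X → X) : Set (Set X) :=
  {D | D ∈ classes f ∧ ∀ ξ : ℕ → X, IsPseudoOrbit U f ξ → ξ 0 ∈ D →
    ∃ x ∈ D, IsShadowedBy V f ξ x}

/-- `𝒟_sh(f) = ⋂_V ⋃_U 𝒟^{V,U}(f)`. -/
def shClasses (f : X → X) : Set (Set X) :=
  ⋂ V : FiniteOpenCover X, ⋃ U : FiniteOpenCover X, shadowingClasses V U f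

/-- The `𝒟`-shadowing property (DSP) of a chain transitive continuous map. Of the three equivalent
forms of the definition this is the formally strongest one, with `U` uniform over all classes; the
other two, `𝒟(f) = 𝒟_sh(f)` and `𝒟_sh(f) ≠ ∅`, follow from it directly, see the two facts below. -/
def HasDSP (f : X → X) : Prop :=
  ∀ V : FiniteOpenCover X, ∃ U : FiniteOpenCover X, classes f = shadowingClasses V U f

theorem HasDSP.classes_eq {f : X → X} (h : HasDSP f) : classes f = shClasses f := by
  ext D
  constructor
  · intro hD
    refine mem_iInter.2 fun V => ?_
    obtain ⟨U, hU⟩ := h V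
    exact mem_iUnion.2 ⟨U, hU ▸ hD⟩
  · intro hD
    have V : FiniteOpenCover X := ⟨{univ}, finite_singleton _, by simp, by simp⟩
    obtain ⟨U, hU⟩ := mem_iUnion.1 (mem_iInter.1 hD V)
    exact hU.1

theorem HasDSP.shClasses_nonempty [Nonempty X] {f : X → X} (h : HasDSP f) :
    (shClasses f).Nonempty := by
  rw [← h.classes_eq]
  exact ⟨_, Classical.arbitrary X, rfl⟩

end DShadowing

/-!
Let `V` be a finite open cover. Since `X` is zero-dimensional and compact, `V` is refined by the
partition into the fibres of some discrete quotient `Q`, and shadowing provides a cover `U` all of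
whose pseudo orbits are shadowed with the same `Q`-itinerary. The point is that a shadowing point
can be found in the class of the initial point of the pseudo orbit.

Fix a cover `W` refining `U` and put `M = m(W)`. The lengths of `W`-chains between two given points
agree modulo `M`, so there is `φ : X → ZMod M` that grows by `k` along every `W`-chain of length `k`
(`exists_phase`), and `φ x = φ y` means `x ∼_{f,W} y`. To a finite `U`-chain attach its set of
phases, the image under `φ` of the points that shadow it. It is a nonempty subset of a finite set,
and inserting a chain as a block of a longer one can only shrink it, up to translation by the length
of the part in front of the block. Hence for a chain `w` with as few phases as possible the phases
of all its extensions are exactly the translates of those of `w`. As only the `Q`-itinerary of `w`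
matters for shadowing, `w` may be taken to be an orbit segment of a point `z`.

Given a finite `U`-chain from `x` to `y`, continue it by a `U`-chain from `y` to `z` and then by the
orbit of `z`. Inserting cycles at `z` (`exists_reach_modEq`) makes the total length before `z`
congruent modulo `M` to the length of a `W`-chain from `x` to `z`, that is, to `φ z - φ x`. By
minimality `φ z` is attained by the translated phases of this chain, so the chain is shadowed by
a point of phase `φ x` (`exists_shadow_coverRel`). Finally, the conditions "shadows up to time `n`"
and "is `∼_{f,W}`-related to `x`" are closed when `W` is a clopen partition, and compactness yields
one point satisfying all of them.
-/

namespace DShadowing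

variable {X : Type*} [TopologicalSpace X]

/-! ### Covers and clopen partitions -/

theorem Close.refl (U : FiniteOpenCover X) (a : X) : Close U a a := by
  have h : a ∈ ⋃₀ U.sets := U.sUnion_sets ▸ mem_univ a
  obtain ⟨W, hW, ha⟩ := h
  exact ⟨W, hW, ha, ha⟩

/-- The cover `W` is at least as fine as `U`, in the sense that `W`-close points are `U`-close. -/
def Refines (W U : FiniteOpenCover X) : Prop :=
  ∀ a b, Close W a b → Close U a b

/-- The finite open cover by the fibres of a discrete quotient. -/
def partitionCover [CompactSpace X] (Q : DiscreteQuotient X) : FiniteOpenCover X where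
  sets := range fun q : Q => Q.proj ⁻¹' {q}
  finite_sets := finite_range _
  isOpen_of_mem := by
    rintro _ ⟨q, rfl⟩
    exact Q.isOpen_preimage _
  sUnion_sets := eq_univ_of_forall fun x => ⟨_, ⟨Q.proj x, rfl⟩, rfl⟩

theorem close_partitionCover [CompactSpace X] (Q : DiscreteQuotient X) (a b : X) :
    Close (partitionCover Q) a b ↔ Q.proj a = Q.proj b := by
  constructor
  · rintro ⟨_, ⟨q, rfl⟩, ha, hb⟩
    exact ha.trans hb.symm
  · intro h
    exact ⟨_, ⟨Q.proj b, rfl⟩, h, rfl⟩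

theorem proj_eq_of_le {P Q : DiscreteQuotient X} (h : P ≤ Q) {a b : X}
    (hab : P.proj a = P.proj b) : Q.proj a = Q.proj b := by
  rw [← DiscreteQuotient.ofLE_proj h a, ← DiscreteQuotient.ofLE_proj h b, hab]

theorem exists_partitionCover_refines [CompactSpace X] [T2Space X] [TotallyDisconnectedSpace X]
    (V : FiniteOpenCover X) : ∃ Q : DiscreteQuotient X, Refines (partitionCover Q) V := by
  have h : ∀ x : X, ∃ A : Set X, IsClopen A ∧ x ∈ A ∧ ∃ W ∈ V.sets, A ⊆ W := by
    intro x
    obtain ⟨W, hW, hx, -⟩ := Close.refl V x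
    obtain ⟨A, hA, hxA, hAW⟩ := compact_exists_isClopen_in_isOpen (V.isOpen_of_mem W hW) hx
    exact ⟨A, hA, hxA, W, hW, hAW⟩
  choose A hA hxA hAW using h
  obtain ⟨t, ht⟩ := isCompact_univ.elim_finite_subcover A (fun x => (hA x).isOpen)
    fun x _ => mem_iUnion.2 ⟨x, hxA x⟩
  refine ⟨t.inf fun x => DiscreteQuotient.ofIsClopen (hA x), fun a b hab => ?_⟩
  rw [close_partitionCover] at hab
  obtain ⟨x, hx, hax⟩ := mem_iUnion₂.1 (ht (mem_univ a))
  have hrel := proj_eq_of_le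
    (Finset.inf_le (f := fun x => DiscreteQuotient.ofIsClopen (hA x)) hx) hab
  have hiff : a ∈ A x ↔ b ∈ A x := Quotient.exact hrel
  obtain ⟨W, hW, hAW⟩ := hAW x
  exact ⟨W, hW, hAW hax, hAW (hiff.1 hax)⟩

/-! ### Chains of prescribed length -/

/-- There is a `U`-chain of `f` of length `k` from `x` to `y`; here `k = 0`, with `x = y`, is
allowed. -/
def Reach (U : FiniteOpenCover X) (f : X → X) (k : ℕ) (x y : X) : Prop :=
  ∃ c : ℕ → X, (∀ i < k, Close U (f (c i)) (c (i + 1))) ∧ c 0 = x ∧ c k = y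

/-- Two finite chains of which the second starts where the first ends can be concatenated. -/
theorem exists_append {U : FiniteOpenCover X} {f : X → X} {k l : ℕ} {c d : ℕ → X}
    (hc : ∀ i < k, Close U (f (c i)) (c (i + 1))) (hd : ∀ i < l, Close U (f (d i)) (d (i + 1)))
    (hcd : c k = d 0) :
    ∃ e : ℕ → X, (∀ i < k + l, Close U (f (e i)) (e (i + 1))) ∧ (∀ i ≤ k, e i = c i) ∧
      ∀ i, e (k + i) = d i := by
  have h₁ : ∀ i ≤ k, (fun i => if i ≤ k then c i else d (i - k)) i = c i := fun i hi => if_pos hi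
  have h₂ : ∀ i, (fun i => if i ≤ k then c i else d (i - k)) (k + i) = d i := by
    intro i
    rcases i.eq_zero_or_pos with rfl | hi
    · simpa using hcd
    · have : ¬ k + i ≤ k := by omega
      simp [this]
  refine ⟨fun i => if i ≤ k then c i else d (i - k), fun i hi => ?_, h₁, h₂⟩
  rcases lt_or_ge i k with hik | hik
  · rw [h₁ i hik.le, h₁ (i + 1) hik]
    exact hc i hik
  · obtain ⟨j, rfl⟩ := Nat.exists_eq_add_of_le hik
    rw [h₂ j, add_assoc, h₂ (j + 1)]
    exact hd j (by omega)

namespace Reach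

variable {U W : FiniteOpenCover X} {f : X → X} {k l : ℕ} {x y z : X}

theorem trans (h₁ : Reach U f k x y) (h₂ : Reach U f l y z) : Reach U f (k + l) x z := by
  obtain ⟨c, hc, rfl, hck⟩ := h₁
  obtain ⟨d, hd, hd0, rfl⟩ := h₂
  obtain ⟨e, he, he₁, he₂⟩ := exists_append hc hd (hck.trans hd0.symm)
  exact ⟨e, he, he₁ 0 (Nat.zero_le _), he₂ l⟩

theorem refl (U : FiniteOpenCover X) (f : X → X) (x : X) : Reach U f 0 x x :=
  ⟨fun _ => x, by simp, rfl, rfl⟩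

theorem mono (hWU : Refines W U) (h : Reach W f k x y) : Reach U f k x y := by
  obtain ⟨c, hc, h0, hk⟩ := h
  exact ⟨c, fun i hi => hWU _ _ (hc i hi), h0, hk⟩

theorem iterate (U : FiniteOpenCover X) (f : X → X) (k : ℕ) (x : X) :
    Reach U f k x (f^[k] x) :=
  ⟨fun i => f^[i] x,
    fun i _ => by simpa only [Function.iterate_succ_apply'] using Close.refl U _, rfl, rfl⟩

theorem nsmul (h : Reach U f k x x) (n : ℕ) : Reach U f (n * k) x x := by
  induction n with
  | zero => simpa using refl U f x
  | succ n ih =>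
    rw [Nat.succ_mul]
    exact ih.trans h

end Reach

/-! ### Cycle lengths and the relation modulo a cover -/

section Gcd

variable {U W : FiniteOpenCover X} {f : X → X} {k l : ℕ} {x y z : X}

theorem mem_cycleLengths : k ∈ cycleLengths U f ↔ 0 < k ∧ ∃ x, Reach U f k x x := by
  constructor
  · rintro ⟨c, ⟨hk, hc⟩, h⟩
    exact ⟨hk, c 0, c, hc, rfl, h.symm⟩
  · rintro ⟨hk, x, c, hc, h0, h⟩
    exact ⟨c, ⟨hk, hc⟩, h0.trans h.symm⟩

theorem coverRel_iff :
    CoverRel U f x y ↔ ∃ k, 0 < k ∧ Reach U f k x y ∧ cycleGcd U f ∣ k := by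
  constructor
  · rintro ⟨k, c, ⟨hk, hc⟩, h0, h, hd⟩
    exact ⟨k, hk, ⟨c, hc, h0, h⟩, hd⟩
  · rintro ⟨k, hk, ⟨c, hc, h0, h⟩, hd⟩
    exact ⟨k, c, ⟨hk, hc⟩, h0, h, hd⟩

theorem ChainTransitive.exists_reach (hct : ChainTransitive f) (U : FiniteOpenCover X) (x y : X) :
    ∃ k, 0 < k ∧ Reach U f k x y := by
  obtain ⟨k, c, ⟨hk, hc⟩, h0, h⟩ := hct x y U
  exact ⟨k, hk, c, hc, h0, h⟩

theorem cycleGcd_mem (hne : (cycleLengths U f).Nonempty) :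
    cycleGcd U f ∈ {d : ℕ | ∀ k ∈ cycleLengths U f, d ∣ k} := by
  obtain ⟨k, hk⟩ := hne
  exact Nat.sSup_mem ⟨1, fun _ _ => one_dvd _⟩
    ⟨k, fun d hd => Nat.le_of_dvd (mem_cycleLengths.1 hk).1 (hd k hk)⟩

theorem cycleGcd_pos (hne : (cycleLengths U f).Nonempty) : 0 < cycleGcd U f := by
  have h := cycleGcd_mem hne
  obtain ⟨k, hk⟩ := hne
  exact Nat.pos_of_dvd_of_pos (h k hk) (mem_cycleLengths.1 hk).1

theorem dvd_cycleGcd (hne : (cycleLengths U f).Nonempty) {d : ℕ}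
    (hd : ∀ k ∈ cycleLengths U f, d ∣ k) : d ∣ cycleGcd U f := by
  have h := cycleGcd_mem hne
  have hpos := cycleGcd_pos hne
  -- the lcm of two common divisors is a common divisor, hence at most the largest one
  have hle : Nat.lcm d (cycleGcd U f) ≤ cycleGcd U f := by
    obtain ⟨k, hk⟩ := hne
    exact le_csSup ⟨k, fun e he => Nat.le_of_dvd (mem_cycleLengths.1 hk).1 (he k hk)⟩
      fun j hj => Nat.lcm_dvd (hd j hj) (h j hj)
  have hd0 : 0 < d := by
    obtain ⟨k, hk⟩ := hne
    exact Nat.pos_of_dvd_of_pos (hd k hk) (mem_cycleLengths.1 hk).1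
  have heq := hle.antisymm (Nat.le_of_dvd (Nat.lcm_pos hd0 hpos) (Nat.dvd_lcm_right _ _))
  exact heq ▸ Nat.dvd_lcm_left d (cycleGcd U f)

theorem ChainTransitive.cycleLengths_nonempty [Nonempty X] (hct : ChainTransitive f)
    (U : FiniteOpenCover X) : (cycleLengths U f).Nonempty := by
  obtain ⟨k, hk, h⟩ := hct.exists_reach U (Classical.arbitrary X) (Classical.arbitrary X)
  exact ⟨k, mem_cycleLengths.2 ⟨hk, _, h⟩⟩

theorem ChainTransitive.cycleGcd_dvd_of_refines [Nonempty X] (hct : ChainTransitive f)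
    (hWU : Refines W U) : cycleGcd U f ∣ cycleGcd W f := by
  refine dvd_cycleGcd (hct.cycleLengths_nonempty W) fun k hk => ?_
  obtain ⟨hk, x, h⟩ := mem_cycleLengths.1 hk
  exact cycleGcd_mem (hct.cycleLengths_nonempty U) k (mem_cycleLengths.2 ⟨hk, x, h.mono hWU⟩)

theorem ChainTransitive.coverRel_mono (hct : ChainTransitive f) (hWU : Refines W U)
    (h : CoverRel W f x y) : CoverRel U f x y := by
  have : Nonempty X := ⟨x⟩
  obtain ⟨k, hk, h, hd⟩ := coverRel_iff.1 h
  exact coverRel_iff.2 ⟨k, hk, h.mono hWU, (hct.cycleGcd_dvd_of_refines hWU).trans hd⟩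

theorem CoverRel.trans (h₁ : CoverRel U f x y) (h₂ : CoverRel U f y z) : CoverRel U f x z := by
  obtain ⟨k, hk, h₁, hk'⟩ := coverRel_iff.1 h₁
  obtain ⟨l, hl, h₂, hl'⟩ := coverRel_iff.1 h₂
  exact coverRel_iff.2 ⟨k + l, by omega, h₁.trans h₂, dvd_add hk' hl'⟩

/-- Every residue class that `m(U)` permits contains the length of a cycle at `z`. -/
theorem ChainTransitive.exists_reach_modEq (hct : ChainTransitive f) (U : FiniteOpenCover X)
    {M : ℕ} (hM : 0 < M) (z : X) {a : ℤ} (ha : (cycleGcd U f : ℤ) ∣ a) :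
    ∃ k, Reach U f k z z ∧ (k : ℤ) ≡ a [ZMOD M] := by
  have : Nonempty X := ⟨z⟩
  -- modulo `M`, the lengths of the cycles at `z` form a subgroup, the inverse of `k` being
  -- `(M - 1) * k`
  let H : AddSubgroup ℤ :=
    { carrier := {a | ∃ k, Reach U f k z z ∧ (k : ℤ) ≡ a [ZMOD M]}
      zero_mem' := ⟨0, Reach.refl U f z, by simp⟩
      add_mem' := by
        rintro a b ⟨k, hk, hka⟩ ⟨l, hl, hlb⟩
        exact ⟨k + l, hk.trans hl, by push_cast; exact hka.add hlb⟩
      neg_mem' := by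
        rintro a ⟨k, hk, hka⟩
        refine ⟨(M - 1) * k, hk.nsmul _, ?_⟩
        refine Int.ModEq.trans ?_ hka.neg
        rw [Int.modEq_iff_dvd]
        refine ⟨-k, ?_⟩
        rw [Nat.cast_mul, Nat.cast_sub hM]
        push_cast
        ring }
  have hcyc : ∀ k ∈ cycleLengths U f, (k : ℤ) ∈ H := by
    intro k hk
    obtain ⟨-, y, hy⟩ := mem_cycleLengths.1 hk
    obtain ⟨p, -, hp⟩ := hct.exists_reach U z y
    obtain ⟨q, -, hq⟩ := hct.exists_reach U y z
    have h₁ : ((p + k + q : ℕ) : ℤ) ∈ H := ⟨_, (hp.trans hy).trans hq, rfl⟩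
    have h₂ : ((p + q : ℕ) : ℤ) ∈ H := ⟨_, hp.trans hq, rfl⟩
    have := H.sub_mem h₁ h₂
    push_cast at this
    convert this using 1
    ring
  obtain ⟨g, hg⟩ := Int.subgroup_cyclic H
  rw [← AddSubgroup.zmultiples_eq_closure] at hg
  have hdvd : g.natAbs ∣ cycleGcd U f := by
    refine dvd_cycleGcd (hct.cycleLengths_nonempty U) fun k hk => ?_
    have := hcyc k hk
    rw [hg, Int.mem_zmultiples_iff] at this
    exact Int.natCast_dvd_natCast.1 ((Int.natAbs_dvd).2 this)
  have : a ∈ H := by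
    rw [hg, Int.mem_zmultiples_iff]
    exact (Int.natAbs_dvd.1 (Int.natCast_dvd_natCast.2 hdvd)).trans ha
  exact this

/-- A phase function: it increases by the length along every chain. -/
theorem ChainTransitive.exists_phase (hct : ChainTransitive f) (W : FiniteOpenCover X) :
    ∃ φ : X → ZMod (cycleGcd W f), ∀ k x y, Reach W f k x y → φ y = φ x + k := by
  rcases isEmpty_or_nonempty X with hX | ⟨⟨p⟩⟩
  · exact ⟨fun _ => 0, fun _ x => hX.elim x⟩
  choose r hr0 hr using fun y => hct.exists_reach W p y
  refine ⟨fun y => r y, fun k x y h => ?_⟩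
  have : Nonempty X := ⟨p⟩
  obtain ⟨c, hc0, hc⟩ := hct.exists_reach W y p
  have hmem : ∀ j, 0 < j → Reach W f j p p → ((j : ℕ) : ZMod (cycleGcd W f)) = 0 :=
    fun j hj h => (ZMod.natCast_eq_zero_iff _ _).2
      (cycleGcd_mem (hct.cycleLengths_nonempty W) j (mem_cycleLengths.2 ⟨hj, p, h⟩))
  have h₁ := hmem _ (by omega) ((hr y).trans hc)
  have h₂ := hmem _ (by omega) (((hr x).trans h).trans hc)
  push_cast at h₁ h₂
  exact add_right_cancel (h₁.trans h₂.symm)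

end Gcd

/-! ### Phases of shadowing points -/

section Phases

variable {α β : Type*} {f : X → X}

/-- The values under `φ` of the points whose itinerary with respect to `π` agrees with that of
`w 0, …, w n`. -/
def phases (f : X → X) (π : X → α) (φ : X → β) (w : ℕ → X) (n : ℕ) : Set β :=
  φ '' {y | ∀ i ≤ n, π (f^[i] y) = π (w i)}

/-- If all `U`-pseudo orbits are shadowed with respect to `π`, then every finite `U`-chain is
shadowed by a point that is related to its initial point modulo any cover finer than `U`. -/
theorem ChainTransitive.exists_shadow_coverRel (hct : ChainTransitive f) {π : X → α}
    {U W : FiniteOpenCover X} (hWU : Refines W U)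
    (hU : ∀ ξ, IsPseudoOrbit U f ξ → ∃ x, ∀ i, π (f^[i] x) = π (ξ i))
    {ξ : ℕ → X} {n : ℕ} (hξ : ∀ i < n, Close U (f (ξ i)) (ξ (i + 1))) :
    ∃ y, (∀ i ≤ n, π (f^[i] y) = π (ξ i)) ∧ CoverRel W f (ξ 0) y := by
  have : Nonempty X := ⟨ξ 0⟩
  have hMpos : 0 < cycleGcd W f := cycleGcd_pos (hct.cycleLengths_nonempty W)
  have : NeZero (cycleGcd W f) := ⟨hMpos.ne'⟩
  obtain ⟨φ, hφ⟩ := hct.exists_phase W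
  have hφf : ∀ k y, φ (f^[k] y) = φ y + k := fun k y => hφ k _ _ (Reach.iterate W f k y)
  have hshadow : ∀ (w : ℕ → X) (n : ℕ), (∀ i < n, Close U (f (w i)) (w (i + 1))) →
      ∃ z, ∀ i ≤ n, π (f^[i] z) = π (w i) := by
    intro w n hw
    -- prolong the chain by the orbit of its last point to an infinite pseudo orbit
    obtain ⟨z, hz⟩ := hU (fun i => if i ≤ n then w i else f^[i - n] (w n)) fun i => by
      rcases lt_trichotomy i n with h | rfl | h
      · simpa [h.le, Nat.succ_le_of_lt h] using hw i h
      · simpa using Close.refl U _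
      · have h₁ : ¬ i ≤ n := by omega
        have h₂ : ¬ i + 1 ≤ n := by omega
        simp only [h₁, h₂, if_false]
        rw [Nat.sub_add_comm h.le, Function.iterate_succ_apply']
        exact Close.refl U _
    exact ⟨z, fun i hi => by simpa [hi] using hz i⟩
  -- a chain with the least number of phases
  obtain ⟨⟨w, N⟩, hw, hmin⟩ : ∃ p : (ℕ → X) × ℕ,
      (∀ i < p.2, Close U (f (p.1 i)) (p.1 (i + 1))) ∧
      ∀ q : (ℕ → X) × ℕ, (∀ i < q.2, Close U (f (q.1 i)) (q.1 (i + 1))) →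
        (phases f π φ p.1 p.2).ncard ≤ (phases f π φ q.1 q.2).ncard := by
    let S : Set ((ℕ → X) × ℕ) := {p | ∀ i < p.2, Close U (f (p.1 i)) (p.1 (i + 1))}
    have hS : S.Nonempty := ⟨(ξ, 0), by simp [S]⟩
    let g : (ℕ → X) × ℕ → ℕ := fun p => (phases f π φ p.1 p.2).ncard
    exact ⟨Function.argminOn g S hS, Function.argminOn_mem g S hS,
      fun q hq => Function.argminOn_le g S hq⟩
  obtain ⟨z, hz⟩ := hshadow w N hw
  -- a chain from the end of `ξ` to `z` with the total length required by the phases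
  obtain ⟨k, hk, hkφ⟩ : ∃ k, Reach U f k (ξ n) z ∧ φ z = φ (ξ 0) + ((n + k : ℕ) : ZMod _) := by
    obtain ⟨l, -, hl⟩ := hct.exists_reach W (ξ 0) z
    obtain ⟨k, -, hk⟩ := hct.exists_reach U (ξ n) z
    obtain ⟨b, hb0, hb⟩ := hct.exists_reach U z (ξ 0)
    have hξn : Reach U f n (ξ 0) (ξ n) := ⟨ξ, hξ, rfl, rfl⟩
    have hmem := cycleGcd_mem (hct.cycleLengths_nonempty U)
    have h₁ := hmem _ (mem_cycleLengths.2 ⟨by omega, _, (hl.mono hWU).trans hb⟩)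
    have h₂ := hmem _ (mem_cycleLengths.2 ⟨by omega, _, (hξn.trans hk).trans hb⟩)
    have h₃ : (cycleGcd U f : ℤ) ∣ (l : ℤ) - (n + k) := by
      have := dvd_sub (Int.natCast_dvd_natCast.2 h₁) (Int.natCast_dvd_natCast.2 h₂)
      push_cast at this
      rwa [add_sub_add_right_eq_sub] at this
    obtain ⟨j, hj, hjl⟩ := hct.exists_reach_modEq U hMpos z h₃
    refine ⟨k + j, hk.trans hj, ?_⟩
    rw [hφ l _ _ hl]
    have := (ZMod.intCast_eq_intCast_iff _ _ _).2 hjl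
    push_cast at this ⊢
    linear_combination -this
  obtain ⟨c, hc, hc0, hck⟩ := hk
  obtain ⟨d, hd, hd₁, hd₂⟩ := exists_append hξ hc hc0.symm
  obtain ⟨e, he, he₁, he₂⟩ := exists_append (l := N) (d := fun i => f^[i] z) hd
    (fun i _ => by simpa only [Function.iterate_succ_apply'] using Close.refl U _)
    ((hd₂ k).trans hck)
  have hsub : (fun s => s + ((n + k : ℕ) : ZMod (cycleGcd W f))) ''
      phases f π φ e (n + k + N) ⊆ phases f π φ w N := by
    rintro _ ⟨_, ⟨y, hy, rfl⟩, rfl⟩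
    refine ⟨f^[n + k] y, fun i hi => ?_, hφf _ _⟩
    rw [← Function.iterate_add_apply, add_comm i, hy _ (by omega), he₂]
    exact hz i hi
  have heq := eq_of_subset_of_ncard_le hsub (by
    rw [ncard_image_of_injective _ (add_left_injective _)]
    exact hmin (e, n + k + N) he)
  have hzmem : φ z ∈ phases f π φ w N := ⟨z, hz, rfl⟩
  rw [← heq] at hzmem
  obtain ⟨_, ⟨y, hy, rfl⟩, hyz⟩ := hzmem
  refine ⟨y, fun i hi => ?_, ?_⟩
  · rw [hy i (by omega), he₁ i (by omega), hd₁ i hi]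
  · have hφy : φ y = φ (ξ 0) := add_right_cancel (hyz.trans hkφ)
    obtain ⟨l, hl0, hl⟩ := hct.exists_reach W (ξ 0) y
    refine coverRel_iff.2 ⟨l, hl0, hl, (ZMod.natCast_eq_zero_iff _ _).1 ?_⟩
    have := hφ l _ _ hl
    rw [hφy] at this
    exact left_eq_add.1 this

end Phases

/-! ### Compactness -/

theorem CoverRel.congr_partitionCover [CompactSpace X] {Q : DiscreteQuotient X} {f : X → X}
    {x y y' : X} (h : CoverRel (partitionCover Q) f x y) (hy : Q.proj y = Q.proj y') :
    CoverRel (partitionCover Q) f x y' := by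
  obtain ⟨k, c, ⟨hk, hc⟩, rfl, rfl, hd⟩ := h
  -- only the last point of the chain has to be moved
  refine ⟨k, Function.update c k y', ⟨hk, fun i hi => ?_⟩, ?_, by simp, hd⟩
  · rw [Function.update_of_ne hi.ne]
    have hci := (close_partitionCover Q _ _).1 (hc i hi)
    rw [close_partitionCover]
    rcases eq_or_ne (i + 1) k with rfl | hne
    · rw [Function.update_self, hci, hy]
    · rw [Function.update_of_ne hne, hci]
  · rw [Function.update_of_ne hk.ne]

theorem isClosed_setOf_coverRel [CompactSpace X] (Q : DiscreteQuotient X) (f : X → X) (x : X) :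
    IsClosed {y | CoverRel (partitionCover Q) f x y} := by
  convert Q.isClosed_preimage (Q.proj '' {y | CoverRel (partitionCover Q) f x y}) using 1
  ext y
  refine ⟨fun h => ⟨y, h, rfl⟩, ?_⟩
  rintro ⟨y', h, hy⟩
  exact h.congr_partitionCover hy

theorem refines_partitionCover_of_le [CompactSpace X] {P Q : DiscreteQuotient X} (h : P ≤ Q) :
    Refines (partitionCover P) (partitionCover Q) := by
  intro a b hab
  rw [close_partitionCover] at hab ⊢
  exact proj_eq_of_le h hab

/-- If all `U`-pseudo orbits are shadowed with respect to a discrete quotient, then each is so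
shadowed by a point equivalent to its initial point. -/
theorem ChainTransitive.exists_shadow_rel [CompactSpace X] [T2Space X] [TotallyDisconnectedSpace X]
    {f : X → X} (hct : ChainTransitive f) (hf : Continuous f) {Q : DiscreteQuotient X}
    {U : FiniteOpenCover X}
    (hU : ∀ ξ, IsPseudoOrbit U f ξ → ∃ x, ∀ i, Q.proj (f^[i] x) = Q.proj (ξ i))
    {ξ : ℕ → X} (hξ : IsPseudoOrbit U f ξ) :
    ∃ y, (∀ i, Q.proj (f^[i] y) = Q.proj (ξ i)) ∧ Rel f (ξ 0) y := by
  obtain ⟨P, hP⟩ := exists_partitionCover_refines U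
  let K : ℕ × DiscreteQuotient X → Set X := fun p =>
    {y | ∀ i ≤ p.1, Q.proj (f^[i] y) = Q.proj (ξ i)} ∩
      {y | CoverRel (partitionCover p.2) f (ξ 0) y}
  have hanti : ∀ {p q : ℕ × DiscreteQuotient X}, p.1 ≤ q.1 → q.2 ≤ p.2 → K q ⊆ K p :=
    fun h₁ h₂ y hy => ⟨fun i hi => hy.1 i (hi.trans h₁),
      hct.coverRel_mono (refines_partitionCover_of_le h₂) hy.2⟩
  have hclosed : ∀ p, IsClosed (K p) := by
    intro p
    refine IsClosed.inter ?_ (isClosed_setOf_coverRel _ _ _)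
    simp only [ofPred_forall]
    exact isClosed_iInter fun i => isClosed_iInter fun _ =>
      (Q.isClosed_preimage {Q.proj (ξ i)}).preimage (hf.iterate i)
  obtain ⟨y, hy⟩ := IsCompact.nonempty_iInter_of_directed_nonempty_isCompact_isClosed K
    (fun p q => ⟨(max p.1 q.1, p.2 ⊓ q.2), hanti (le_max_left _ _) inf_le_left,
      hanti (le_max_right _ _) inf_le_right⟩)
    (fun p => by
      have hPU : Refines (partitionCover (p.2 ⊓ P)) U := fun a b hab =>
        hP a b (refines_partitionCover_of_le inf_le_right a b hab)
      obtain ⟨y, hy, hrel⟩ := hct.exists_shadow_coverRel hPU hU (n := p.1) fun i _ => hξ i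
      exact ⟨y, hy, hct.coverRel_mono (refines_partitionCover_of_le inf_le_left) hrel⟩)
    (fun p => (hclosed p).isCompact) hclosed
  rw [mem_iInter] at hy
  refine ⟨y, fun i => (hy (i, ⊤)).1 i le_rfl, fun W => ?_⟩
  obtain ⟨R, hR⟩ := exists_partitionCover_refines W
  exact hct.coverRel_mono hR (hy (0, R)).2

end DShadowing

theorem theorem1p4 {X : Type*} [TopologicalSpace X] [CompactSpace X] [T2Space X]
    [TotallyDisconnectedSpace X] (f : X → X) (hf : Continuous f)
    (hct : DShadowing.ChainTransitive f) (hsh : DShadowing.HasShadowing f) :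
    DShadowing.HasDSP f := by
  intro V
  obtain ⟨Q, hQ⟩ := DShadowing.exists_partitionCover_refines V
  obtain ⟨U, hU⟩ := hsh (DShadowing.partitionCover Q)
  refine ⟨U, Subset.antisymm (fun D hD => ⟨hD, fun ξ hξ hξD => ?_⟩) fun D hD => hD.1⟩
  obtain ⟨x, rfl⟩ := hD
  obtain ⟨y, hy, hrel⟩ := hct.exists_shadow_rel hf (Q := Q) (fun η hη => by
    obtain ⟨p, hp⟩ := hU η hη
    exact ⟨p, fun i => (DShadowing.close_partitionCover Q _ _).1 (hp i)⟩) hξ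
  exact ⟨y, fun W => (hξD W).trans (hrel W),
    fun i => hQ _ _ ((DShadowing.close_partitionCover Q _ _).2 (hy i))⟩
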